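/- Let $h>0$ and let $m,p,q,d\in\mathbb{R}$ satisfy $-p\ge q\ge 0$. Consider the linear delayed equation $$u_t(t,x)=u_{xx}(t,x)+m\,u_x(t,x)+p\,u(t,x)+q\,u(t-h,x+d),\qquad t>0,\ x\in\mathbb{R}. \tag{1}$$ For $u_0\in C([-h,0];L^1(\mathbb{R}))$ put $C_{u_0}:=\sup_{s\in[-h,0]}\|u_0(s,\cdot)\|_{L^1(\mathbb{R})}$. A solution of (1) with initial datum $u_0$ is a function $u\in C([-h,\infty);L^1(\mathbb{R}))$ with $u=u_0$ on $[-h,0]$ that satisfies (1) in the sense of distributions in $x$ for every $t>0$: for all $\varphi\in C_c^\infty(\mathbb{R})$ and all $t>0$, $$\frac{d}{dt}\int_{\mathbb{R}}u(t,x)\varphi(x)\,dx=\int_{\mathbb{R}}u(t,x)\bigl(\varphi''(x)-m\varphi'(x)+p\varphi(x)\bigr)dx+q\int_{\mathbb{R}}u(t-h,x+d)\varphi(x)\,dx .$$ Theorem. The equation $\gamma-p=q\,e^{-h\gamma}$ has exactly one real solution $\gamma$, and $\gamma\le 0$. If $u$ is a solution of (1) with initial datum $u_0\in C([-h,0];L^1(\mathbb{R}))$,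 then for every $t>h/2$ the function $u(t,\cdot)$ has a bounded continuous representative, and, for this representative, $$\sup_{x\in\mathbb{R}}|u(t,x)|\le A_0\,\frac{e^{\gamma t}}{\sqrt t},\qquad A_0=\frac{C_{u_0}}{2}\,\sqrt{1+h(\gamma-p)},$$ with strict inequality whenever $u_0\not\equiv 0$. -/

import Mathlib

open MeasureTheory Set
open scoped ContDiff

/-- The real space `L¹(ℝ)` (Lebesgue measure). -/
abbrev L1R : Type := Lp ℝ 1 (volume : Measure ℝ)

/-- The phase space `C([-h,0]; L¹(ℝ))`. -/
abbrev InitialDatum (h : ℝ) : Type := C(Icc (-h) (0 : ℝ), L1R)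

/-- `C_{u₀} = sup_{s ∈ [-h,0]} ‖u₀(s,·)‖_{L¹}`. -/
noncomputable def initialSize {h : ℝ} (u₀ : InitialDatum h) : ℝ :=
  ⨆ s : Icc (-h) (0 : ℝ), ‖u₀ s‖

/-- `u ∈ C([-h,∞); L¹(ℝ))` is the solution with initial datum `u₀` of
`u_t(t,x) = u_xx(t,x) + m u_x(t,x) + p u(t,x) + q u(t-h,x+d)`, `t > 0`, `x ∈ ℝ`.

The equation is understood in the sense of distributions in `x`: for every test function
`φ ∈ C_c^∞(ℝ)`, the pairing `t ↦ ∫ u(t,x) φ(x) dx` is differentiable at each `t > 0` with the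
derivative prescribed by the right-hand side (derivatives in `x` being moved onto `φ`).
The values of `u t` for `t < -h` play no role. -/
structure IsDelaySolution (h m p q d : ℝ) (u₀ : InitialDatum h) (u : ℝ → L1R) : Prop where
  continuousOn : ContinuousOn u (Ici (-h))
  initial : ∀ s : Icc (-h) (0 : ℝ), u s = u₀ s
  equation : ∀ φ : ℝ → ℝ, ContDiff ℝ ∞ φ → HasCompactSupport φ → ∀ t : ℝ, 0 < t →
    HasDerivAt (fun τ : ℝ => ∫ x, u τ x * φ x)
      ((∫ x, u t x * deriv (deriv φ) x) - m * (∫ x, u t x * deriv φ x)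
        + p * (∫ x, u t x * φ x) + q * (∫ x, u (t - h) (x + d) * φ x)) t

/-!
Write `a = γ - p`. The Fourier transform `f(t) = ∫ u(t, x) e^{-iξx} dx` of a solution satisfies, for
each fixed frequency `ξ`, the scalar delay equation
`f'(t) = (p - ξ² + i m ξ) f(t) + q e^{i d ξ} f(t - h)`, and `|f| ≤ C_{u₀}` on `[-h, 0]`
(`IsDelaySolution.hasDerivAt_fourierPairing`). The function `e^{γ t} / (1 + t ξ² / (1 + h a))`,
continued by `1` to `t ≤ 0`, is a supersolution of the associated real equation
(`profile_supersolution`), so a comparison argument gives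
`|f(t)| < C_{u₀} e^{γ t} / (1 + t ξ² / (1 + h a))` for all `t > 0`, `ξ ≠ 0`, as soon as `C_{u₀} > 0`
(`norm_lt_profile_of_delay_ode`).

The bound is a Cauchy kernel in `ξ`, with integral `π √(1 + h a) / √t` times `C_{u₀} e^{γ t}`. By
Fourier inversion (`ae_eq_fourierInv_fourier`), `u(t, ·)` has a continuous representative whose
supremum is at most `(2π)⁻¹ ∫ |f(t)| dξ`, and this is the asserted estimate. The argument applies at
every time `t > 0`.

Since the equation is given only for compactly supported test functions, it is first extended to
smooth functions bounded with two derivatives, among them `cos (ξ x)` and `sin (ξ x)`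
(`IsDelaySolution.hasDerivAt_integral_mul`).
-/

open scoped FourierTransform

/-! ### The characteristic equation -/
theorem existsUnique_characteristic_root {h p q : ℝ} (hh : 0 < h) (hq : 0 ≤ q) (hpq : q ≤ -p) :
    ∃ γ : ℝ, γ ≤ 0 ∧ γ - p = q * Real.exp (-h * γ) ∧
      ∀ γ' : ℝ, γ' - p = q * Real.exp (-h * γ') → γ' = γ := by
  set G : ℝ → ℝ := fun γ => γ - p - q * Real.exp (-h * γ) with hG
  have hmono : StrictMono G := by
    intro x y hxy
    have : Real.exp (-h * y) ≤ Real.exp (-h * x) := Real.exp_le_exp.2 (by nlinarith)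
    have := mul_le_mul_of_nonneg_left this hq
    simp only [hG]
    linarith
  have hcont : Continuous G := by fun_prop
  have h0 : 0 ≤ G 0 := by simp [hG]; linarith
  have h1 : G p ≤ 0 := by
    have := mul_nonneg hq (Real.exp_pos (-h * p)).le
    simp only [hG]; linarith
  obtain ⟨γ, hγ, hγ0⟩ := intermediate_value_Icc (by linarith : p ≤ 0) hcont.continuousOn ⟨h1, h0⟩
  refine ⟨γ, hγ.2, by simp only [hG] at hγ0; linarith, fun γ' h' => hmono.injective ?_⟩
  rw [hγ0]; simp only [hG]; linarith

/-! ### Comparison for the scalar delay equation -/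

/-- For a frequency `ξ ≠ 0` put `η = ξ² / (1 + h a)`, `a = γ - p`. The profile equal to
`e^{γ t} / (1 + t η)` for `t > 0` and to `1` for `t ≤ 0` is a strict supersolution of the scalar
delay equation `y' = (p - ξ²) y + q y(t - h)`: the coefficient on the right is `γ + ξ² - p` plus the
logarithmic derivative of `1 / (1 + t η)`. For `t > h` the essential inequality is
`(1 + h η) (1 + (t - h) η) ≥ 1 + t η`; for `t ≤ h` it is `1 + h η ≥ 1 + t η`, together with
`e^{γ h} ≤ e^{γ t}`, which uses `γ ≤ 0`. -/
theorem profile_supersolution {h q a γ η t : ℝ} (hh : 0 < h) (hγ : γ ≤ 0)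
    (ha : a = q * Real.exp (-h * γ)) (hq : 0 ≤ q) (hη : 0 < η) (ht : 0 < t) :
    q * (if t ≤ h then 1 else Real.exp (γ * (t - h)) / (1 + (t - h) * η)) <
      (a + η * (1 + h * a) - η / (1 + t * η)) * (Real.exp (γ * t) / (1 + t * η)) := by
  have ha0 : 0 ≤ a := ha ▸ mul_nonneg hq (Real.exp_pos _).le
  have hden : 0 < 1 + t * η := by positivity
  have hE := Real.exp_pos (γ * t)
  have hqa : q = a * Real.exp (h * γ) := by
    rw [ha, mul_assoc, ← Real.exp_add]; simp
  -- The coefficient is `a (1 + h η)` plus a strictly positive remainder.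
  have hcoef : a + η * (1 + h * a) - η / (1 + t * η) = a * (1 + h * η) + t * η ^ 2 / (1 + t * η) := by
    field_simp; ring
  have hlt : a * (1 + h * η) * (Real.exp (γ * t) / (1 + t * η)) <
      (a + η * (1 + h * a) - η / (1 + t * η)) * (Real.exp (γ * t) / (1 + t * η)) := by
    rw [hcoef]
    have : 0 < t * η ^ 2 / (1 + t * η) := by positivity
    gcongr
    linarith
  refine lt_of_le_of_lt ?_ hlt
  split_ifs with hth
  · have h1 : Real.exp (h * γ) ≤ Real.exp (γ * t) := Real.exp_le_exp.2 (by nlinarith)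
    rw [mul_one, hqa, mul_assoc]
    refine mul_le_mul_of_nonneg_left (h1.trans ?_) ha0
    rw [mul_div_assoc', le_div_iff₀ hden, mul_comm]
    gcongr
  · push Not at hth
    have hth' : 0 < t - h := sub_pos.2 hth
    have h1 : Real.exp (h * γ) * Real.exp (γ * (t - h)) = Real.exp (γ * t) := by
      rw [← Real.exp_add]; ring_nf
    rw [hqa, mul_assoc, mul_div_assoc', h1, mul_assoc]
    refine mul_le_mul_of_nonneg_left ?_ ha0
    rw [mul_div_assoc', div_le_div_iff₀ (by positivity) hden]
    have : 0 ≤ h * (t - h) * η ^ 2 := by positivity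
    nlinarith

/-- Comparison principle for a complex scalar delay equation, by the method of steps. After
multiplication by the integrating factor and a rotation, the difference between `C` times the
profile and the solution is a real function, nonnegative at `0` and with positive derivative. -/
theorem norm_lt_profile_of_delay_ode {h p q γ C η : ℝ} {c e : ℂ} {f : ℝ → ℂ}
    (hh : 0 < h) (hγ : γ ≤ 0) (hγp : γ - p = q * Real.exp (-h * γ)) (hq : 0 ≤ q)
    (hη : 0 < η) (hC : 0 < C) (hc : c.re = p - η * (1 + h * (γ - p))) (he : ‖e‖ ≤ q)
    (hcont : ContinuousOn f (Ici 0))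
    (hderiv : ∀ t, 0 < t → HasDerivAt f (c * f t + e * f (t - h)) t)
    (hinit : ∀ s ∈ Icc (-h) 0, ‖f s‖ ≤ C) {t : ℝ} (ht : 0 < t) :
    ‖f t‖ < C * (Real.exp (γ * t) / (1 + t * η)) := by
  suffices H : ∀ n : ℕ, ∀ t, 0 < t → t ≤ n * h → ‖f t‖ < C * (Real.exp (γ * t) / (1 + t * η)) by
    obtain ⟨n, hn⟩ := exists_nat_ge (t / h)
    exact H n t ht ((div_le_iff₀ hh).1 hn)
  clear ht t
  intro n
  induction n with
  | zero => intro t h0 h1; simp at h1; linarith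
  | succ n ih =>
    intro T hT hTn
    push_cast at hTn
    -- The delayed value is controlled by the profile extended by `1` to negative times.
    have hdelay : ∀ t, 0 < t → t ≤ T →
        ‖f (t - h)‖ ≤ C * (if t ≤ h then 1 else Real.exp (γ * (t - h)) / (1 + (t - h) * η)) := by
      intro t ht htT
      split_ifs with hth
      · simpa using hinit (t - h) ⟨by linarith, by linarith⟩
      · exact (ih (t - h) (by linarith) (by linarith)).le
    -- The unit `z` rotates the solution at the final time `T` onto the positive real axis.
    obtain ⟨z, hz, hzT⟩ : ∃ z : ℂ, ‖z‖ = 1 ∧ z * (Complex.exp (-c * T) * f T) =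
        (‖Complex.exp (-c * T) * f T‖ : ℂ) := by
      obtain ⟨z, hz, h2⟩ := RCLike.exists_norm_eq_mul_self (Complex.exp (-c * T) * f T)
      exact ⟨z, hz, h2.symm⟩
    have hcexp : ∀ t : ℝ, ‖Complex.exp (-c * t)‖ = Real.exp (-c.re * t) := by
      intro t; rw [Complex.norm_exp]; simp
    set D : ℝ → ℝ := fun t => C * (Real.exp (-c.re * t) * (Real.exp (γ * t) / (1 + t * η))) -
      (z * (Complex.exp (-c * t) * f t)).re with hD
    have hDcont : ContinuousOn D (Icc 0 T) := by
      have h1 : ContinuousOn f (Icc 0 T) := hcont.mono Icc_subset_Ici_self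
      have h2 : ∀ t ∈ Icc 0 T, 1 + t * η ≠ 0 := fun t ht => by have := ht.1; positivity
      have h3 : ContinuousOn (fun t : ℝ => z * (Complex.exp (-c * t) * f t)) (Icc 0 T) := by
        fun_prop
      refine ContinuousOn.sub ?_ (Complex.continuous_re.comp_continuousOn h3)
      fun_prop (disch := assumption)
    have hDd : ∀ t, 0 < t → HasDerivAt D
        (C * (Real.exp (-c.re * t) * ((-c.re + γ - η / (1 + t * η)) *
          (Real.exp (γ * t) / (1 + t * η)))) -
          (z * (Complex.exp (-c * t) * (e * f (t - h)))).re) t := by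
      intro t ht
      have hden : 1 + t * η ≠ 0 := by positivity
      have h1 : HasDerivAt (fun t : ℝ => z * (Complex.exp (-c * t) * f t))
          (z * (Complex.exp (-c * t) * (e * f (t - h)))) t := by
        have h2 : HasDerivAt (fun t : ℝ => Complex.exp (-c * t)) (Complex.exp (-c * t) * -c) t := by
          have := ((hasDerivAt_id (t : ℂ)).const_mul (-c)).cexp.comp_ofReal
          simpa using this
        have := (h2.mul (hderiv t ht)).const_mul z
        refine HasDerivAt.congr_deriv this ?_
        ring
      have h3 : HasDerivAt (fun t : ℝ => (z * (Complex.exp (-c * t) * f t)).re)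
          (z * (Complex.exp (-c * t) * (e * f (t - h)))).re t :=
        (Complex.reCLM.hasFDerivAt.comp_hasDerivAt t h1)
      refine HasDerivAt.sub ?_ h3
      have e1 : HasDerivAt (fun t : ℝ => Real.exp (-c.re * t)) (Real.exp (-c.re * t) * -c.re) t := by
        simpa using ((hasDerivAt_id t).const_mul (-c.re)).exp
      have e2 : HasDerivAt (fun t : ℝ => Real.exp (γ * t)) (Real.exp (γ * t) * γ) t := by
        simpa using ((hasDerivAt_id t).const_mul γ).exp
      have e3 : HasDerivAt (fun t : ℝ => 1 + t * η) η t := by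
        simpa using ((hasDerivAt_id t).mul_const η).const_add 1
      refine HasDerivAt.congr_deriv ((e1.mul (e2.div e3 hden)).const_mul C) ?_
      rw [Pi.div_apply]
      field_simp
      ring
    have hDpos : ∀ t ∈ interior (Icc 0 T), 0 < deriv D t := by
      intro t ht
      rw [interior_Icc] at ht
      rw [(hDd t ht.1).deriv, sub_pos]
      refine (Complex.re_le_norm _).trans_lt ?_
      rw [norm_mul, norm_mul, norm_mul, hz, one_mul, hcexp]
      have hs := profile_supersolution hh hγ hγp hq hη ht.1
      have hd := hdelay t ht.1 ht.2.le
      have hEpos := Real.exp_pos (-c.re * t)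
      calc Real.exp (-c.re * t) * (‖e‖ * ‖f (t - h)‖)
          ≤ Real.exp (-c.re * t) * (q * (C * (if t ≤ h then 1 else
              Real.exp (γ * (t - h)) / (1 + (t - h) * η)))) := by gcongr
        _ = C * (Real.exp (-c.re * t) * (q * (if t ≤ h then 1 else
              Real.exp (γ * (t - h)) / (1 + (t - h) * η)))) := by ring
        _ < _ := by
          refine mul_lt_mul_of_pos_left (mul_lt_mul_of_pos_left (hs.trans_eq ?_) hEpos) hC
          rw [hc]; ring
    have hmono := strictMonoOn_of_deriv_pos (convex_Icc 0 T) hDcont hDpos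
    have hlt := hmono (left_mem_Icc.2 hT.le) (right_mem_Icc.2 hT.le) hT
    have h0 : 0 ≤ D 0 := by
      simp only [hD, Complex.ofReal_zero, mul_zero, Complex.exp_zero, one_mul, Real.exp_zero,
        zero_mul, add_zero, div_one, mul_one, sub_nonneg]
      refine (Complex.re_le_norm _).trans ?_
      rw [norm_mul, hz, one_mul]
      exact hinit 0 ⟨by linarith, le_rfl⟩
    have hDT := h0.trans_lt hlt
    simp only [hD] at hDT
    rw [hzT, Complex.ofReal_re, norm_mul, hcexp, sub_pos] at hDT
    have : Real.exp (-c.re * T) * ‖f T‖ <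
        Real.exp (-c.re * T) * (C * (Real.exp (γ * T) / (1 + T * η))) := by linarith
    exact lt_of_mul_lt_mul_left this (Real.exp_pos _).le

/-! ### Pairings of integrable functions with bounded functions -/
theorem integrable_mul_of_bounded (g : L1R) {ψ : ℝ → ℝ} (hψ : Continuous ψ) {K : ℝ}
    (hK : ∀ x, |ψ x| ≤ K) : Integrable (fun x => g x * ψ x) := by
  have := (L1.integrable_coeFn g).bdd_mul (c := K) hψ.aestronglyMeasurable
    (Filter.Eventually.of_forall hK)
  simpa only [mul_comm] using this

theorem abs_integral_mul_le (g : L1R) {ψ : ℝ → ℝ} {K : ℝ}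
    (hK : ∀ x, |ψ x| ≤ K) : |∫ x, g x * ψ x| ≤ K * ‖g‖ := by
  rw [L1.norm_eq_integral_norm, ← integral_const_mul, ← Real.norm_eq_abs]
  refine norm_integral_le_of_norm_le ((L1.integrable_coeFn g).norm.const_mul K) ?_
  refine Filter.Eventually.of_forall fun x => ?_
  rw [norm_mul, mul_comm]
  exact mul_le_mul_of_nonneg_right (hK x) (norm_nonneg _)

theorem continuousOn_integral_mul {u : ℝ → L1R} {S : Set ℝ} (hu : ContinuousOn u S) {ψ : ℝ → ℝ}
    (hψ : Continuous ψ) {K : ℝ} (hK : ∀ x, |ψ x| ≤ K) :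
    ContinuousOn (fun τ => ∫ x, u τ x * ψ x) S := by
  have hlip : LipschitzWith (Real.toNNReal K) (fun g : L1R => ∫ x, g x * ψ x) := by
    refine LipschitzWith.of_dist_le_mul fun f g => ?_
    have hK0 : 0 ≤ K := (abs_nonneg _).trans (hK 0)
    rw [dist_eq_norm, dist_eq_norm, Real.coe_toNNReal _ hK0,
      ← integral_sub (integrable_mul_of_bounded f hψ hK) (integrable_mul_of_bounded g hψ hK)]
    refine le_trans (le_of_eq ?_) (abs_integral_mul_le (f - g) hK)
    rw [Real.norm_eq_abs]
    congr 1
    refine integral_congr_ae ?_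
    filter_upwards [Lp.coeFn_sub f g] with x hx
    rw [hx, Pi.sub_apply]; ring
  exact hlip.continuous.comp_continuousOn hu

theorem tendsto_integral_mul_of_bounded (g : L1R) {ψ : ℕ → ℝ → ℝ} {ψ' : ℝ → ℝ} {K : ℝ}
    (hψ : ∀ n, Continuous (ψ n)) (hK : ∀ n x, |ψ n x| ≤ K)
    (hlim : ∀ x, Filter.Tendsto (fun n => ψ n x) Filter.atTop (nhds (ψ' x))) :
    Filter.Tendsto (fun n => ∫ x, g x * ψ n x) Filter.atTop (nhds (∫ x, g x * ψ' x)) := by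
  refine tendsto_integral_of_dominated_convergence (fun x => K * ‖g x‖)
    (fun n => (integrable_mul_of_bounded g (hψ n) (hK n)).aestronglyMeasurable)
    ((L1.integrable_coeFn g).norm.const_mul K) (fun n => ?_) ?_
  · refine Filter.Eventually.of_forall fun x => ?_
    rw [norm_mul, mul_comm]
    exact mul_le_mul_of_nonneg_right (hK n x) (norm_nonneg _)
  · exact Filter.Eventually.of_forall fun x => (hlim x).const_mul _

/-! ### The weak equation for bounded test functions -/

/-- The right-hand side of the equation at time `τ` tested against `φ`, where `ψ₁` and `ψ₂` stand
for `φ'` and `φ''`. The translation of the delayed term is moved onto `φ`. -/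
noncomputable def testedRHS (h m p q d : ℝ) (u : ℝ → L1R) (φ ψ₁ ψ₂ : ℝ → ℝ) (τ : ℝ) : ℝ :=
  (∫ x, u τ x * ψ₂ x) - m * (∫ x, u τ x * ψ₁ x) + p * (∫ x, u τ x * φ x)
    + q * (∫ x, u (τ - h) x * φ (x - d))

theorem continuousOn_testedRHS {h m p q d K : ℝ} (hh : 0 ≤ h) {u : ℝ → L1R}
    (hu : ContinuousOn u (Ici (-h)))
    {φ ψ₁ ψ₂ : ℝ → ℝ} (c0 : Continuous φ) (c1 : Continuous ψ₁) (c2 : Continuous ψ₂)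
    (h0 : ∀ x, |φ x| ≤ K) (h1 : ∀ x, |ψ₁ x| ≤ K) (h2 : ∀ x, |ψ₂ x| ≤ K) :
    ContinuousOn (testedRHS h m p q d u φ ψ₁ ψ₂) (Ici 0) := by
  have hu0 : ContinuousOn u (Ici 0) := hu.mono (Ici_subset_Ici.2 (by linarith))
  have hud : ContinuousOn (fun τ => u (τ - h)) (Ici 0) :=
    hu.comp (by fun_prop) fun τ hτ => by
      rw [mem_Ici] at hτ ⊢; linarith
  exact (((continuousOn_integral_mul hu0 c2 h2).sub
    ((continuousOn_integral_mul hu0 c1 h1).const_mul m)).add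
    ((continuousOn_integral_mul hu0 c0 h0).const_mul p)).add
    ((continuousOn_integral_mul hud (c0.comp (continuous_id.sub continuous_const))
      (fun x => h0 (x - d))).const_mul q)

/-- A smooth function bounded with its first two derivatives is the pointwise limit, derivatives
included and with uniform bounds, of the test functions `φ(x) χ(x / (n + 1))`, where `χ` is a bump
function equal to `1` near `0`. -/
theorem exists_cutoff_sequence {φ : ℝ → ℝ} (hφ : ContDiff ℝ ∞ φ) {K : ℝ}
    (h0 : ∀ x, |φ x| ≤ K) (h1 : ∀ x, |deriv φ x| ≤ K) (h2 : ∀ x, |deriv (deriv φ) x| ≤ K) :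
    ∃ (M : ℝ) (ψ : ℕ → ℝ → ℝ), (∀ n, ContDiff ℝ ∞ (ψ n)) ∧ (∀ n, HasCompactSupport (ψ n)) ∧
      (∀ n x, |ψ n x| ≤ M) ∧ (∀ n x, |deriv (ψ n) x| ≤ M) ∧
      (∀ n x, |deriv (deriv (ψ n)) x| ≤ M) ∧
      (∀ x, Filter.Tendsto (fun n => ψ n x) Filter.atTop (nhds (φ x))) ∧
      (∀ x, Filter.Tendsto (fun n => deriv (ψ n) x) Filter.atTop (nhds (deriv φ x))) ∧
      (∀ x, Filter.Tendsto (fun n => deriv (deriv (ψ n)) x) Filter.atTop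
        (nhds (deriv (deriv φ) x))) := by
  let B : ContDiffBump (0 : ℝ) := ⟨1, 2, by norm_num, by norm_num⟩
  set χ : ℝ → ℝ := fun x => B x with hχ
  have hχs : ContDiff ℝ ∞ χ := B.contDiff
  have hχc : HasCompactSupport χ := B.hasCompactSupport
  have hχ0 : χ =ᶠ[nhds 0] fun _ => 1 := B.eventuallyEq_one
  have hχs1 : ContDiff ℝ ∞ (deriv χ) := (contDiff_infty_iff_deriv.1 hχs).2
  have hχs2 : ContDiff ℝ ∞ (deriv (deriv χ)) := (contDiff_infty_iff_deriv.1 hχs1).2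
  have hφs1 : ContDiff ℝ ∞ (deriv φ) := (contDiff_infty_iff_deriv.1 hφ).2
  have hφs2 : ContDiff ℝ ∞ (deriv (deriv φ)) := (contDiff_infty_iff_deriv.1 hφs1).2
  obtain ⟨L0, hL0⟩ := hχs.continuous.bounded_above_of_compact_support hχc
  obtain ⟨L1, hL1⟩ := hχs1.continuous.bounded_above_of_compact_support hχc.deriv
  obtain ⟨L2, hL2⟩ := hχs2.continuous.bounded_above_of_compact_support hχc.deriv.deriv
  simp only [Real.norm_eq_abs] at hL0 hL1 hL2
  have hK : 0 ≤ K := (abs_nonneg _).trans (h0 0)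
  have hL0' : 0 ≤ L0 := (abs_nonneg _).trans (hL0 0)
  have hL1' : 0 ≤ L1 := (abs_nonneg _).trans (hL1 0)
  have hL2' : 0 ≤ L2 := (abs_nonneg _).trans (hL2 0)
  set δ : ℕ → ℝ := fun n => 1 / ((n : ℝ) + 1) with hδ
  have hδ0 : ∀ n, 0 < δ n := fun n => by positivity
  have hδ1 : ∀ n, δ n ≤ 1 := fun n => by
    rw [hδ]; simp only; rw [div_le_one (by positivity)]; linarith [(Nat.cast_nonneg n : (0:ℝ) ≤ n)]
  have hδl : Filter.Tendsto δ Filter.atTop (nhds 0) := tendsto_one_div_add_atTop_nhds_zero_nat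
  have hδx : ∀ x, Filter.Tendsto (fun n => δ n * x) Filter.atTop (nhds 0) := fun x => by
    simpa using hδl.mul_const x
  have hχl : ∀ x, Filter.Tendsto (fun n => χ (δ n * x)) Filter.atTop (nhds 1) := fun x =>
    (hχ0.comp_tendsto (hδx x)).tendsto
  -- A factor `δ n` times bounded quantities tends to zero.
  have hsmall : ∀ (x : ℝ) (F : ℝ → ℝ), Continuous F → ∀ c : ℝ,
      Filter.Tendsto (fun n => δ n * (c * F (δ n * x))) Filter.atTop (nhds 0) := by
    intro x F hF c
    have := hδl.mul (((hF.tendsto 0).comp (hδx x)).const_mul c)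
    simpa using this
  have hd1 : ∀ n, deriv (fun x => φ x * χ (δ n * x)) =
      fun x => deriv φ x * χ (δ n * x) + δ n * (φ x * deriv χ (δ n * x)) := by
    intro n; funext x
    have e1 : HasDerivAt φ (deriv φ x) x := (hφ.differentiable (by simp) x).hasDerivAt
    have e2 : HasDerivAt (fun x => χ (δ n * x)) (deriv χ (δ n * x) * δ n) x := by
      have := (hχs.differentiable (by simp) (δ n * x)).hasDerivAt
      exact this.comp x (by simpa using (hasDerivAt_id x).const_mul (δ n))
    refine (e1.mul e2).deriv.trans ?_
    ring
  have hd2 : ∀ n, deriv (deriv (fun x => φ x * χ (δ n * x))) =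
      fun x => deriv (deriv φ) x * χ (δ n * x) + δ n * ((2 * deriv φ x) * deriv χ (δ n * x))
        + δ n * (δ n * (φ x * deriv (deriv χ) (δ n * x))) := by
    intro n; rw [hd1]; funext x
    have e0 : HasDerivAt φ (deriv φ x) x := (hφ.differentiable (by simp) x).hasDerivAt
    have e1 : HasDerivAt (deriv φ) (deriv (deriv φ) x) x :=
      (hφs1.differentiable (by simp) x).hasDerivAt
    have l1 : HasDerivAt (fun x => δ n * x) (δ n) x := by
      simpa using (hasDerivAt_id x).const_mul (δ n)
    have e2 : HasDerivAt (fun x => χ (δ n * x)) (deriv χ (δ n * x) * δ n) x :=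
      ((hχs.differentiable (by simp) (δ n * x)).hasDerivAt).comp x l1
    have e3 : HasDerivAt (fun x => deriv χ (δ n * x)) (deriv (deriv χ) (δ n * x) * δ n) x :=
      ((hχs1.differentiable (by simp) (δ n * x)).hasDerivAt).comp x l1
    refine ((e1.mul e2).add ((e0.mul e3).const_mul (δ n))).deriv.trans ?_
    ring
  have hb0 : ∀ n x, |φ x * χ (δ n * x)| ≤ K * L0 := fun n x => by
    rw [abs_mul]; exact mul_le_mul (h0 x) (hL0 _) (abs_nonneg _) hK
  have hA : 0 ≤ K * L0 := by positivity
  have hB : 0 ≤ K * L1 := by positivity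
  have hC : 0 ≤ K * L2 := by positivity
  have hδabs : ∀ n (z : ℝ), |δ n * z| ≤ |z| := fun n z => by
    rw [abs_mul, abs_of_pos (hδ0 n)]
    exact mul_le_of_le_one_left (abs_nonneg z) (hδ1 n)
  refine ⟨K * L0 + 2 * (K * L1) + K * L2, fun n x => φ x * χ (δ n * x), fun n => ?_, fun n => ?_,
    fun n x => ?_, fun n x => ?_, fun n x => ?_, fun x => ?_, fun x => ?_, fun x => ?_⟩
  · exact hφ.mul (hχs.comp (contDiff_const.mul contDiff_id))
  · exact (hχc.comp_homeomorph (Homeomorph.mulLeft₀ (δ n) (hδ0 n).ne')).mul_left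
  · linarith [hb0 n x]
  · rw [hd1]
    have t1 : |deriv φ x * χ (δ n * x)| ≤ K * L0 := by
      rw [abs_mul]; exact mul_le_mul (h1 x) (hL0 _) (abs_nonneg _) hK
    have t2 : |φ x * deriv χ (δ n * x)| ≤ K * L1 := by
      rw [abs_mul]; exact mul_le_mul (h0 x) (hL1 _) (abs_nonneg _) hK
    refine (abs_add_le _ _).trans ?_
    linarith [hδabs n (φ x * deriv χ (δ n * x))]
  · rw [hd2]
    have t1 : |deriv (deriv φ) x * χ (δ n * x)| ≤ K * L0 := by
      rw [abs_mul]; exact mul_le_mul (h2 x) (hL0 _) (abs_nonneg _) hK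
    have t2 : |2 * deriv φ x * deriv χ (δ n * x)| ≤ 2 * (K * L1) := by
      rw [mul_assoc, abs_mul, abs_mul, abs_two]
      exact mul_le_mul_of_nonneg_left (mul_le_mul (h1 x) (hL1 _) (abs_nonneg _) hK) zero_le_two
    have t3 : |φ x * deriv (deriv χ) (δ n * x)| ≤ K * L2 := by
      rw [abs_mul]; exact mul_le_mul (h0 x) (hL2 _) (abs_nonneg _) hK
    refine (abs_add_three _ _ _).trans ?_
    linarith [hδabs n (2 * deriv φ x * deriv χ (δ n * x)),
      hδabs n (δ n * (φ x * deriv (deriv χ) (δ n * x))),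
      hδabs n (φ x * deriv (deriv χ) (δ n * x))]
  · simpa using (hχl x).const_mul (φ x)
  · simp only [hd1]
    simpa using ((hχl x).const_mul (deriv φ x)).add (hsmall x _ hχs1.continuous (φ x))
  · simp only [hd2]
    simpa using (((hχl x).const_mul (deriv (deriv φ) x)).add
      (hsmall x _ hχs1.continuous (2 * deriv φ x))).add
      (hδl.mul (hsmall x _ hχs2.continuous (φ x)))

/-- The weak equation, postulated for compactly supported test functions, holds for every smooth
`φ` bounded with its first two derivatives. Cutting `φ` off, integrating the equation in time and
passing to the limit by dominated convergence gives the integrated identity for `φ`; its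
right-hand side is continuous in time, so it can be differentiated. -/
theorem IsDelaySolution.hasDerivAt_integral_mul {h m p q d : ℝ} (hh : 0 < h) {u₀ : InitialDatum h}
    {u : ℝ → L1R} (hu : IsDelaySolution h m p q d u₀ u) {φ : ℝ → ℝ} (hφ : ContDiff ℝ ∞ φ) {K : ℝ}
    (h0 : ∀ x, |φ x| ≤ K) (h1 : ∀ x, |deriv φ x| ≤ K) (h2 : ∀ x, |deriv (deriv φ) x| ≤ K)
    {t : ℝ} (ht : 0 < t) :
    HasDerivAt (fun τ => ∫ x, u τ x * φ x)
      (testedRHS h m p q d u φ (deriv φ) (deriv (deriv φ)) t) t := by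
  obtain ⟨M, ψ, hψ, hψc, b0, b1, b2, l0, l1, l2⟩ := exists_cutoff_sequence hφ h0 h1 h2
  have hc1 : ∀ {g : ℝ → ℝ}, ContDiff ℝ ∞ g → ContDiff ℝ ∞ (deriv g) := fun hg =>
    (contDiff_infty_iff_deriv.1 hg).2
  have hRcont : ContinuousOn (testedRHS h m p q d u φ (deriv φ) (deriv (deriv φ))) (Ici 0) :=
    continuousOn_testedRHS hh.le hu.continuousOn hφ.continuous (hc1 hφ).continuous
      (hc1 (hc1 hφ)).continuous h0 h1 h2
  have hRncont : ∀ n, ContinuousOn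
      (testedRHS h m p q d u (ψ n) (deriv (ψ n)) (deriv (deriv (ψ n)))) (Ici 0) := fun n =>
    continuousOn_testedRHS hh.le hu.continuousOn (hψ n).continuous (hc1 (hψ n)).continuous
      (hc1 (hc1 (hψ n))).continuous (b0 n) (b1 n) (b2 n)
  have hM : 0 ≤ M := (abs_nonneg _).trans (b0 0 0)
  -- The integrated identity for the truncated test functions.
  have hint : ∀ n, ∀ s ∈ Ici (t / 2),
      ∫ τ in (t / 2)..s, testedRHS h m p q d u (ψ n) (deriv (ψ n)) (deriv (deriv (ψ n))) τ =
        (∫ x, u s x * ψ n x) - ∫ x, u (t / 2) x * ψ n x := by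
    intro n s hs
    have hsub : uIcc (t / 2) s ⊆ Ioi 0 := by
      rw [uIcc_of_le hs]; intro τ hτ; exact lt_of_lt_of_le (by positivity) hτ.1
    refine intervalIntegral.integral_eq_sub_of_hasDerivAt
      (f := fun τ => ∫ x, u τ x * ψ n x) (fun τ hτ => ?_) ?_
    · refine (hu.equation (ψ n) (hψ n) (hψc n) τ (hsub hτ)).congr_deriv ?_
      rw [testedRHS, ← integral_add_right_eq_self (fun x => u (τ - h) x * ψ n (x - d)) d]
      simp
    · exact ((hRncont n).mono (hsub.trans Ioi_subset_Ici_self)).intervalIntegrable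
  have hlimR : ∀ τ, Filter.Tendsto
      (fun n => testedRHS h m p q d u (ψ n) (deriv (ψ n)) (deriv (deriv (ψ n))) τ) Filter.atTop
      (nhds (testedRHS h m p q d u φ (deriv φ) (deriv (deriv φ)) τ)) := by
    intro τ
    exact (((tendsto_integral_mul_of_bounded _ (fun n => (hc1 (hc1 (hψ n))).continuous) b2 l2).sub
      ((tendsto_integral_mul_of_bounded _ (fun n => (hc1 (hψ n)).continuous) b1 l1).const_mul m)).add
      ((tendsto_integral_mul_of_bounded _ (fun n => (hψ n).continuous) b0 l0).const_mul p)).add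
      ((tendsto_integral_mul_of_bounded _
        (fun n => (hψ n).continuous.comp (continuous_id.sub continuous_const))
        (fun n x => b0 n (x - d)) (fun x => l0 (x - d))).const_mul q)
  have hlim : ∀ s ∈ Ici (t / 2),
      ∫ τ in (t / 2)..s, testedRHS h m p q d u φ (deriv φ) (deriv (deriv φ)) τ =
        (∫ x, u s x * φ x) - ∫ x, u (t / 2) x * φ x := by
    intro s hs
    have hsub : Ioc (t / 2) s ⊆ Ici 0 := fun τ hτ =>
      (le_of_lt (lt_trans (by positivity) hτ.1) : 0 ≤ τ)
    have hucont : ContinuousOn (fun τ => ‖u τ‖) (Icc (-h) s) :=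
      (hu.continuousOn.mono Icc_subset_Ici_self).norm
    obtain ⟨U, hU⟩ := isCompact_Icc.bddAbove_image hucont
    have hU' : ∀ τ ∈ Icc (-h) s, ‖u τ‖ ≤ U := fun τ hτ => hU ⟨τ, hτ, rfl⟩
    have hleft := intervalIntegral.tendsto_integral_filter_of_dominated_convergence
      (a := t / 2) (b := s) (μ := volume) (l := Filter.atTop)
      (F := fun n => testedRHS h m p q d u (ψ n) (deriv (ψ n)) (deriv (deriv (ψ n))))
      (f := testedRHS h m p q d u φ (deriv φ) (deriv (deriv φ)))
      (fun _ => M * U + |m| * (M * U) + |p| * (M * U) + |q| * (M * U))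
      (Filter.Eventually.of_forall fun n => by
        rw [uIoc_of_le hs]
        exact ((hRncont n).mono hsub).aestronglyMeasurable measurableSet_Ioc)
      (Filter.Eventually.of_forall fun n => Filter.Eventually.of_forall fun τ hτ => by
        rw [uIoc_of_le hs] at hτ
        have hτ0 : 0 ≤ τ := hsub hτ
        have n1 : M * ‖u τ‖ ≤ M * U :=
          mul_le_mul_of_nonneg_left (hU' τ ⟨by linarith, hτ.2⟩) hM
        have n2 : M * ‖u (τ - h)‖ ≤ M * U :=
          mul_le_mul_of_nonneg_left (hU' (τ - h) ⟨by linarith, by linarith [hτ.2]⟩) hM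
        have i0 := (abs_integral_mul_le (u τ) (b0 n)).trans n1
        have i1 := (abs_integral_mul_le (u τ) (b1 n)).trans n1
        have i2 := (abs_integral_mul_le (u τ) (b2 n)).trans n1
        have i3 := (abs_integral_mul_le (u (τ - h)) (fun x => b0 n (x - d))).trans n2
        rw [testedRHS, Real.norm_eq_abs]
        refine (abs_add_le _ _).trans (add_le_add ((abs_add_le _ _).trans (add_le_add
          ((abs_sub _ _).trans (add_le_add i2 ?_)) ?_)) ?_) <;> rw [abs_mul] <;> gcongr)
      intervalIntegrable_const
      (Filter.Eventually.of_forall fun τ _ => hlimR τ)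
    refine tendsto_nhds_unique hleft ?_
    simp only [hint _ s hs]
    exact (tendsto_integral_mul_of_bounded _ (fun n => (hψ n).continuous) b0 l0).sub
      (tendsto_integral_mul_of_bounded _ (fun n => (hψ n).continuous) b0 l0)
  have hnhds : Ici (0 : ℝ) ∈ nhds t := Ici_mem_nhds ht
  -- Integration starts at `t / 2` because the equation holds at positive times only.
  have hftc : HasDerivAt
      (fun s => ∫ τ in (t / 2)..s, testedRHS h m p q d u φ (deriv φ) (deriv (deriv φ)) τ)
      (testedRHS h m p q d u φ (deriv φ) (deriv (deriv φ)) t) t := by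
    refine intervalIntegral.integral_hasDerivAt_right ?_
      ((hRcont.mono Ioi_subset_Ici_self).stronglyMeasurableAtFilter isOpen_Ioi t ht)
      (hRcont.continuousAt hnhds)
    refine (hRcont.mono ?_).intervalIntegrable
    rw [uIcc_of_le (by linarith)]
    exact fun τ hτ => (by linarith [hτ.1] : (0 : ℝ) ≤ τ)
  refine (hftc.add_const (∫ x, u (t / 2) x * φ x)).congr_of_eventuallyEq ?_
  filter_upwards [Ici_mem_nhds (show t / 2 < t by linarith)] with s hs
  rw [hlim s hs]; ring

/-! ### Fourier inversion for integrable functions -/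
theorem continuous_fourierInv_of_integrable {f : ℝ → ℂ} (hf : Integrable f) :
    Continuous (𝓕⁻ f : ℝ → ℂ) :=
  VectorFourier.fourierIntegral_continuous Real.continuous_fourierChar
    (continuous_inner.neg) hf

/-- Fourier inversion for an integrable function with integrable transform, without assuming
continuity: both sides have the same integral against every test function `G = 𝓕 (𝓕⁻ G)`, by
self-adjointness of `𝓕` and `𝓕⁻`. -/
theorem ae_eq_fourierInv_fourier {f : ℝ → ℂ} (hf : Integrable f) (hf' : Integrable (𝓕 f)) :
    (𝓕⁻ (𝓕 f) : ℝ → ℂ) =ᵐ[volume] f := by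
  refine ae_eq_of_integral_contDiff_smul_eq
    (continuous_fourierInv_of_integrable hf').locallyIntegrable hf.locallyIntegrable ?_
  intro g hg hgc
  have hgc' : HasCompactSupport (fun x => (g x : ℂ)) := hgc.comp_left Complex.ofReal_zero
  have hgs : ContDiff ℝ ∞ (fun x => (g x : ℂ)) := Complex.ofRealCLM.contDiff.comp hg
  set G : SchwartzMap ℝ ℂ := hgc'.toSchwartzMap hgs with hG
  have hGg : ∀ x, G x = (g x : ℂ) := fun x => rfl
  have e1 : ∫ x, (𝓕⁻ (G : ℝ → ℂ)) x • (𝓕 f) x = ∫ x, G x • (𝓕⁻ (𝓕 f) : ℝ → ℂ) x := by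
    have := VectorFourier.integral_fourierIntegral_smul_eq_flip (L := -innerₗ ℝ)
      Real.continuous_fourierChar (continuous_inner.neg) (G.integrable (μ := volume)) hf'
    have hflip : (-innerₗ ℝ : ℝ →ₗ[ℝ] ℝ →ₗ[ℝ] ℝ).flip = -innerₗ ℝ := by
      ext; simp
    rw [hflip] at this
    exact this
  have e2 : ∫ x, (𝓕 (𝓕⁻ (G : ℝ → ℂ))) x • f x = ∫ x, (𝓕⁻ (G : ℝ → ℂ)) x • (𝓕 f) x := by
    have hi : Integrable (𝓕⁻ (G : ℝ → ℂ)) := by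
      rw [← SchwartzMap.fourierInv_coe]; exact (𝓕⁻ G).integrable
    have := VectorFourier.integral_fourierIntegral_smul_eq_flip (L := innerₗ ℝ)
      Real.continuous_fourierChar (continuous_inner) hi hf
    simpa using! this
  have e3 : (𝓕 (𝓕⁻ (G : ℝ → ℂ)) : ℝ → ℂ) = G := by
    rw [← SchwartzMap.fourierInv_coe, ← SchwartzMap.fourier_coe,
      FourierTransform.fourier_fourierInv_eq]
  rw [e3, e1] at e2
  simpa [hGg] using e2.symm

/-! ### The equation in the Fourier variable -/

/-- The Fourier transform at frequency `ξ / (2π)` of a real `L¹` function, i.e. its pairing with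
`e^{-iξx}`, split into the pairings with `cos (ξ x)` and `sin (ξ x)` since test functions are
real-valued. -/
noncomputable def fourierPairing (ξ : ℝ) (g : L1R) : ℂ :=
  ((∫ x, g x * Real.cos (ξ * x) : ℝ) : ℂ) - Complex.I * ((∫ x, g x * Real.sin (ξ * x) : ℝ) : ℂ)

theorem abs_cos_mul_le_one (ξ x : ℝ) : |Real.cos (ξ * x)| ≤ 1 := Real.abs_cos_le_one _

theorem abs_sin_mul_le_one (ξ x : ℝ) : |Real.sin (ξ * x)| ≤ 1 := Real.abs_sin_le_one _

theorem fourier_coe_eq_fourierPairing (g : L1R) (v : ℝ) :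
    𝓕 (fun x => (g x : ℂ)) v = fourierPairing (2 * Real.pi * v) g := by
  have hc := integrable_mul_of_bounded g (ψ := fun x => Real.cos (2 * Real.pi * v * x))
    (by fun_prop) (abs_cos_mul_le_one _)
  have hs := integrable_mul_of_bounded g (ψ := fun x => Real.sin (2 * Real.pi * v * x))
    (by fun_prop) (abs_sin_mul_le_one _)
  rw [Real.fourier_real_eq_integral_exp_smul, fourierPairing, ← integral_complex_ofReal,
    ← integral_complex_ofReal,
    ← integral_const_mul, ← integral_sub hc.ofReal (hs.ofReal.const_mul _)]
  congr 1
  funext x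
  have : ((-2 * Real.pi * x * v : ℝ) : ℂ) * Complex.I
      = ((-(2 * Real.pi * v * x) : ℝ) : ℂ) * Complex.I := by push_cast; ring
  rw [this, Complex.exp_mul_I, ← Complex.ofReal_cos, ← Complex.ofReal_sin, Real.cos_neg,
    Real.sin_neg, smul_eq_mul]
  push_cast
  ring

theorem norm_fourierPairing_le (ξ : ℝ) (g : L1R) : ‖fourierPairing ξ g‖ ≤ ‖g‖ := by
  have h : ξ = 2 * Real.pi * (ξ / (2 * Real.pi)) := by field_simp
  rw [h, ← fourier_coe_eq_fourierPairing, L1.norm_eq_integral_norm]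
  refine (VectorFourier.norm_fourierIntegral_le_integral_norm _ _ _ _ _).trans (le_of_eq ?_)
  simp

theorem continuousOn_fourierPairing {u : ℝ → L1R} {S : Set ℝ} (hu : ContinuousOn u S) (ξ : ℝ) :
    ContinuousOn (fun t => fourierPairing ξ (u t)) S := by
  have hc := continuousOn_integral_mul hu (ψ := fun x => Real.cos (ξ * x)) (by fun_prop)
    (abs_cos_mul_le_one ξ)
  have hs := continuousOn_integral_mul hu (ψ := fun x => Real.sin (ξ * x)) (by fun_prop)
    (abs_sin_mul_le_one ξ)
  exact (Complex.continuous_ofReal.comp_continuousOn hc).sub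
    ((Complex.continuous_ofReal.comp_continuousOn hs).const_mul Complex.I)

theorem deriv_cos_mul (ξ : ℝ) :
    deriv (fun x => Real.cos (ξ * x)) = fun x => -ξ * Real.sin (ξ * x) := by
  funext x
  have h := ((hasDerivAt_id x).const_mul ξ).cos
  simp only [id, mul_one] at h
  rw [h.deriv]; ring

theorem deriv_sin_mul (ξ : ℝ) :
    deriv (fun x => Real.sin (ξ * x)) = fun x => ξ * Real.cos (ξ * x) := by
  funext x
  have h := ((hasDerivAt_id x).const_mul ξ).sin
  simp only [id, mul_one] at h
  rw [h.deriv]; ring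

/-- In the Fourier variable the equation is a scalar delay equation; the drift `m` and the
translation `d` only contribute an imaginary part and a phase. -/
theorem IsDelaySolution.hasDerivAt_fourierPairing {h m p q d : ℝ} (hh : 0 < h)
    {u₀ : InitialDatum h} {u : ℝ → L1R} (hu : IsDelaySolution h m p q d u₀ u) (ξ : ℝ) {t : ℝ}
    (ht : 0 < t) :
    HasDerivAt (fun τ => fourierPairing ξ (u τ))
      (((p - ξ ^ 2 : ℝ) + (m * ξ : ℝ) * Complex.I) * fourierPairing ξ (u t) +
        (q * Complex.exp ((ξ * d : ℝ) * Complex.I)) * fourierPairing ξ (u (t - h))) t := by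
  have hdc2 : deriv (deriv fun x => Real.cos (ξ * x)) = fun x => -ξ ^ 2 * Real.cos (ξ * x) := by
    rw [deriv_cos_mul, deriv_const_mul_field', deriv_sin_mul]; funext x; ring
  have hds2 : deriv (deriv fun x => Real.sin (ξ * x)) = fun x => -ξ ^ 2 * Real.sin (ξ * x) := by
    rw [deriv_sin_mul, deriv_const_mul_field', deriv_cos_mul]; funext x; ring
  set c : L1R → ℝ := fun g => ∫ x, g x * Real.cos (ξ * x) with hc
  set s : L1R → ℝ := fun g => ∫ x, g x * Real.sin (ξ * x) with hs
  have hconst : ∀ (g : L1R) (a : ℝ) (ψ : ℝ → ℝ),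
      ∫ x, g x * (a * ψ x) = a * ∫ x, g x * ψ x := fun g a ψ => by
    rw [← integral_const_mul]; congr 1; funext x; ring
  have hci : ∀ g : L1R, Integrable (fun x => g x * Real.cos (ξ * x)) := fun g =>
    integrable_mul_of_bounded g (by fun_prop) (abs_cos_mul_le_one ξ)
  have hsi : ∀ g : L1R, Integrable (fun x => g x * Real.sin (ξ * x)) := fun g =>
    integrable_mul_of_bounded g (by fun_prop) (abs_sin_mul_le_one ξ)
  have hcd : ∀ g : L1R, ∫ x, g x * Real.cos (ξ * (x - d)) =
      Real.cos (ξ * d) * c g + Real.sin (ξ * d) * s g := fun g => by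
    rw [hc, hs, ← integral_const_mul, ← integral_const_mul,
      ← integral_add ((hci g).const_mul _) ((hsi g).const_mul _)]
    congr 1; funext x
    rw [mul_sub, Real.cos_sub]; ring
  have hsd : ∀ g : L1R, ∫ x, g x * Real.sin (ξ * (x - d)) =
      Real.cos (ξ * d) * s g - Real.sin (ξ * d) * c g := fun g => by
    rw [hc, hs, ← integral_const_mul, ← integral_const_mul,
      ← integral_sub ((hsi g).const_mul _) ((hci g).const_mul _)]
    congr 1; funext x
    rw [mul_sub, Real.sin_sub]; ring
  have hK1 : ∀ y : ℝ, |y| ≤ 1 → |y| ≤ 1 + |ξ| + |ξ| ^ 2 := fun y hy =>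
    hy.trans (by have := abs_nonneg ξ; nlinarith)
  have hK2 : ∀ y : ℝ, |y| ≤ 1 → |ξ * y| ≤ 1 + |ξ| + |ξ| ^ 2 := fun y hy => by
    rw [abs_mul]
    exact (mul_le_of_le_one_right (abs_nonneg ξ) hy).trans (by have := sq_nonneg |ξ|; linarith)
  have hK3 : ∀ y : ℝ, |y| ≤ 1 → |-ξ ^ 2 * y| ≤ 1 + |ξ| + |ξ| ^ 2 := fun y hy => by
    rw [abs_mul, abs_neg, abs_pow]
    exact (mul_le_of_le_one_right (by positivity) hy).trans (by have := abs_nonneg ξ; linarith)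
  have hdc : HasDerivAt (fun τ => c (u τ)) (-ξ ^ 2 * c (u t) - m * (-ξ * s (u t)) + p * c (u t) +
      q * (Real.cos (ξ * d) * c (u (t - h)) + Real.sin (ξ * d) * s (u (t - h)))) t := by
    have := hu.hasDerivAt_integral_mul hh (φ := fun x => Real.cos (ξ * x)) (by fun_prop)
      (fun x => hK1 _ (Real.abs_cos_le_one _))
      (fun x => by
        rw [deriv_cos_mul]; simpa using hK2 _ (Real.abs_sin_le_one (ξ * x)))
      (fun x => by rw [hdc2]; exact hK3 _ (Real.abs_cos_le_one _)) ht
    rwa [hdc2, deriv_cos_mul, testedRHS, hconst, hconst, hcd] at this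
  have hds : HasDerivAt (fun τ => s (u τ)) (-ξ ^ 2 * s (u t) - m * (ξ * c (u t)) + p * s (u t) +
      q * (Real.cos (ξ * d) * s (u (t - h)) - Real.sin (ξ * d) * c (u (t - h)))) t := by
    have := hu.hasDerivAt_integral_mul hh (φ := fun x => Real.sin (ξ * x)) (by fun_prop)
      (fun x => hK1 _ (Real.abs_sin_le_one _))
      (fun x => by rw [deriv_sin_mul]; exact hK2 _ (Real.abs_cos_le_one _))
      (fun x => by rw [hds2]; exact hK3 _ (Real.abs_sin_le_one _)) ht
    rwa [hds2, deriv_sin_mul, testedRHS, hconst, hconst, hsd] at this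
  refine (hdc.ofReal_comp.sub (hds.ofReal_comp.const_mul Complex.I)).congr_deriv ?_
  rw [Complex.exp_mul_I, ← Complex.ofReal_cos, ← Complex.ofReal_sin]
  simp only [fourierPairing]
  change _ = (((p - ξ ^ 2 : ℝ) : ℂ) + ((m * ξ : ℝ) : ℂ) * Complex.I) *
      ((c (u t) : ℂ) - Complex.I * (s (u t) : ℂ)) +
    (q * ((Real.cos (ξ * d) : ℂ) + (Real.sin (ξ * d) : ℂ) * Complex.I)) *
      ((c (u (t - h)) : ℂ) - Complex.I * (s (u (t - h)) : ℂ))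
  generalize Real.cos (ξ * d) = κ
  generalize Real.sin (ξ * d) = σ
  push_cast
  linear_combination (-(m * ξ * s (u t)) - q * σ * s (u (t - h)) : ℂ) * (-Complex.I_sq)

/-! ### From frequency bounds to the supremum norm -/
theorem exists_continuous_representative (g : L1R)
    (hg : Integrable (𝓕 (fun x => (g x : ℂ)) : ℝ → ℂ)) :
    ∃ w : ℝ → ℝ, Continuous w ∧ w =ᵐ[volume] (g : ℝ → ℝ) ∧
      ∀ x, |w x| ≤ ∫ v, ‖𝓕 (fun x => (g x : ℂ)) v‖ := by
  have hgi : Integrable (fun x => (g x : ℂ)) := (L1.integrable_coeFn g).ofReal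
  refine ⟨fun x => ((𝓕⁻ (𝓕 (fun x => (g x : ℂ))) : ℝ → ℂ) x).re,
    Complex.continuous_re.comp (continuous_fourierInv_of_integrable hg), ?_, fun x => ?_⟩
  · filter_upwards [ae_eq_fourierInv_fourier hgi hg] with x hx
    rw [hx, Complex.ofReal_re]
  · exact (Complex.abs_re_le_norm _).trans
      (VectorFourier.norm_fourierIntegral_le_integral_norm _ _ _ _ _)

/-- A strict pointwise bound away from `0` by a multiple of the Cauchy kernel `(1 + (b v)²)⁻¹`,
whose integral is `π / b`, gives a strict bound of the integral. -/
theorem integrable_and_integral_norm_lt_of_norm_lt_cauchy {F : ℝ → ℂ} {A b : ℝ} (hb : 0 < b)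
    (hF : Continuous F) (h : ∀ v, v ≠ 0 → ‖F v‖ < A * (1 + (b * v) ^ 2)⁻¹) :
    Integrable F ∧ ∫ v, ‖F v‖ < A * (Real.pi / b) := by
  have hi : Integrable (fun v : ℝ => A * (1 + (b * v) ^ 2)⁻¹) :=
    (integrable_inv_one_add_sq.comp_mul_left' hb.ne').const_mul A
  have hval : ∫ v : ℝ, A * (1 + (b * v) ^ 2)⁻¹ = A * (Real.pi / b) := by
    rw [integral_const_mul, Measure.integral_comp_mul_left (fun v : ℝ => (1 + v ^ 2)⁻¹) b,
      integral_univ_inv_one_add_sq, abs_of_pos (inv_pos.2 hb), smul_eq_mul, div_eq_inv_mul]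
  have hae : ∀ᵐ v : ℝ, v ≠ 0 := by simp [ae_iff]
  have hFi : Integrable F := hi.mono' hF.aestronglyMeasurable (hae.mono fun v hv => (h v hv).le)
  refine ⟨hFi, ?_⟩
  rw [← hval, ← sub_pos, ← integral_sub hi hFi.norm, integral_pos_iff_support_of_nonneg_ae
    (hae.mono fun v hv => sub_nonneg.2 (h v hv).le) (hi.sub hFi.norm)]
  have hsub : Ioo (0 : ℝ) 1 ⊆
      Function.support (fun v => A * (1 + (b * v) ^ 2)⁻¹ - ‖F v‖) := fun v hv =>
    (sub_pos.2 (h v hv.1.ne')).ne'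
  exact lt_of_lt_of_le (by simp) (measure_mono hsub)

/-- The comparison principle applied at frequency `ξ = 2 π v`. The zero frequency is excluded since
equality can hold there. -/
theorem IsDelaySolution.norm_fourier_lt {h m p q d γ C : ℝ} (hh : 0 < h) (hq : 0 ≤ q)
    (hγ : γ ≤ 0) (hγp : γ - p = q * Real.exp (-h * γ)) {u₀ : InitialDatum h} {u : ℝ → L1R}
    (hu : IsDelaySolution h m p q d u₀ u) (hC : 0 < C) (hCu : ∀ s, ‖u₀ s‖ ≤ C) {t : ℝ}
    (ht : 0 < t) {v : ℝ} (hv : v ≠ 0) :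
    ‖𝓕 (fun x => (u t x : ℂ)) v‖ < C * Real.exp (γ * t) *
      (1 + (2 * Real.pi * Real.sqrt (t / (1 + h * (γ - p))) * v) ^ 2)⁻¹ := by
  have ha : 0 ≤ γ - p := hγp ▸ mul_nonneg hq (Real.exp_pos _).le
  have hS : 0 < 1 + h * (γ - p) := by positivity
  have hpi := Real.pi_pos
  rw [fourier_coe_eq_fourierPairing]
  set ξ := 2 * Real.pi * v with hξ
  have hξ0 : ξ ≠ 0 := by positivity
  have hη : 0 < ξ ^ 2 / (1 + h * (γ - p)) := by positivity
  have key := norm_lt_profile_of_delay_ode (f := fun τ => fourierPairing ξ (u τ))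
    (c := ((p - ξ ^ 2 : ℝ) : ℂ) + ((m * ξ : ℝ) : ℂ) * Complex.I)
    (e := q * Complex.exp ((ξ * d : ℝ) * Complex.I)) hh hγ hγp hq hη hC
    (by
      rw [Complex.add_re, Complex.re_ofReal_mul, Complex.I_re, Complex.ofReal_re]
      field_simp
      ring)
    (by
      rw [norm_mul, Complex.norm_exp_ofReal_mul_I, Complex.norm_real, Real.norm_eq_abs,
        abs_of_nonneg hq, mul_one])
    (continuousOn_fourierPairing (hu.continuousOn.mono (Ici_subset_Ici.2 (by linarith))) ξ)
    (fun τ hτ => hu.hasDerivAt_fourierPairing hh ξ hτ)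
    (fun s hs => by
      refine (norm_fourierPairing_le ξ _).trans ?_
      rw [hu.initial ⟨s, hs⟩]
      exact hCu _) ht
  refine key.trans_eq ?_
  have : (2 * Real.pi * Real.sqrt (t / (1 + h * (γ - p))) * v) ^ 2 =
      t * (ξ ^ 2 / (1 + h * (γ - p))) := by
    rw [mul_right_comm, mul_pow, Real.sq_sqrt (by positivity)]
    ring
  rw [this]; ring

theorem norm_le_initialSize {h : ℝ} (u₀ : InitialDatum h) (s : Icc (-h) (0 : ℝ)) :
    ‖u₀ s‖ ≤ initialSize u₀ :=
  le_ciSup (f := fun s => ‖u₀ s‖)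
    (isCompact_range (u₀.continuous.norm)).bddAbove s

theorem initialSize_pos {h : ℝ} {u₀ : InitialDatum h} (hu₀ : u₀ ≠ 0) : 0 < initialSize u₀ := by
  obtain ⟨s, hs⟩ := DFunLike.ne_iff.1 hu₀
  exact (norm_pos_iff.2 hs).trans_le (norm_le_initialSize u₀ s)

theorem initialSize_nonneg {h : ℝ} (u₀ : InitialDatum h) : 0 ≤ initialSize u₀ :=
  Real.iSup_nonneg fun _ => norm_nonneg _

theorem mainTheorem4 (h m p q d : ℝ) (hh : 0 < h) (hq : 0 ≤ q) (hpq : q ≤ -p) :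
    ∃ γ : ℝ, γ ≤ 0 ∧ γ - p = q * Real.exp (-h * γ) ∧
      (∀ γ' : ℝ, γ' - p = q * Real.exp (-h * γ') → γ' = γ) ∧
      ∀ (u₀ : InitialDatum h) (u : ℝ → L1R), IsDelaySolution h m p q d u₀ u →
        ∀ t : ℝ, h / 2 < t →
          ∃ w : ℝ → ℝ, Continuous w ∧ w =ᵐ[volume] (u t : ℝ → ℝ) ∧
            BddAbove (range fun x => |w x|) ∧
            (⨆ x, |w x|) ≤ initialSize u₀ / 2 * Real.sqrt (1 + h * (γ - p))
              * (Real.exp (γ * t) / Real.sqrt t) ∧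
            (u₀ ≠ 0 → (⨆ x, |w x|) < initialSize u₀ / 2 * Real.sqrt (1 + h * (γ - p))
              * (Real.exp (γ * t) / Real.sqrt t)) := by
  obtain ⟨γ, hγ, hγp, huniq⟩ := existsUnique_characteristic_root hh hq hpq
  refine ⟨γ, hγ, hγp, huniq, fun u₀ u hu t hth => ?_⟩
  have ht : 0 < t := by linarith
  have ha : 0 ≤ γ - p := hγp ▸ mul_nonneg hq (Real.exp_pos _).le
  have hS : 0 < 1 + h * (γ - p) := by positivity
  have hpi := Real.pi_pos
  set b : ℝ := 2 * Real.pi * Real.sqrt (t / (1 + h * (γ - p))) with hb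
  have hb0 : 0 < b := by positivity
  have hcont : Continuous (𝓕 (fun x => (u t x : ℂ)) : ℝ → ℂ) :=
    VectorFourier.fourierIntegral_continuous Real.continuous_fourierChar continuous_inner
      (L1.integrable_coeFn (u t)).ofReal
  have hbound : ∀ C : ℝ, 0 < C → initialSize u₀ ≤ C →
      Integrable (𝓕 (fun x => (u t x : ℂ)) : ℝ → ℂ) ∧
      ∫ v, ‖𝓕 (fun x => (u t x : ℂ)) v‖ <
        C / 2 * Real.sqrt (1 + h * (γ - p)) * (Real.exp (γ * t) / Real.sqrt t) := by
    intro C hC hCu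
    have := integrable_and_integral_norm_lt_of_norm_lt_cauchy hb0 hcont fun v hv =>
      hu.norm_fourier_lt hh hq hγ hγp hC (fun s => (norm_le_initialSize u₀ s).trans hCu) ht hv
    refine ⟨this.1, this.2.trans_eq ?_⟩
    rw [hb, Real.sqrt_div ht.le]
    field_simp
  have hC1 := initialSize_nonneg u₀
  obtain ⟨w, hw, hwae, hwle⟩ := exists_continuous_representative (u t)
    (hbound (initialSize u₀ + 1) (by linarith) (by linarith)).1
  have hsup : (⨆ x, |w x|) ≤ ∫ v, ‖𝓕 (fun x => (u t x : ℂ)) v‖ := ciSup_le hwle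
  refine ⟨w, hw, hwae, ⟨_, forall_mem_range.2 hwle⟩, hsup.trans ?_, fun hu₀ =>
    hsup.trans_lt (hbound _ (initialSize_pos hu₀) le_rfl).2⟩
  -- The comparison needs a positive constant; letting `C` decrease to `C_{u₀}` covers `u₀ = 0`.
  have hlim : Filter.Tendsto (fun C : ℝ => C / 2 * Real.sqrt (1 + h * (γ - p)) *
      (Real.exp (γ * t) / Real.sqrt t)) (nhdsWithin (initialSize u₀) (Ioi (initialSize u₀)))
      (nhds (initialSize u₀ / 2 * Real.sqrt (1 + h * (γ - p)) *
        (Real.exp (γ * t) / Real.sqrt t))) :=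
    ((by fun_prop : Continuous fun C : ℝ => C / 2 * Real.sqrt (1 + h * (γ - p)) *
      (Real.exp (γ * t) / Real.sqrt t)).tendsto _).mono_left nhdsWithin_le_nhds
  refine ge_of_tendsto hlim ?_
  filter_upwards [self_mem_nhdsWithin] with C hC
  exact (hbound C (hC1.trans_lt hC) (le_of_lt hC)).2.le
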